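/- Let $Q$ be a smooth finite-dimensional manifold with a Riemannian metric $g$, and let $D\subseteq TQ$ be a smooth distribution of constant rank $k$ on $Q$. Let $\pi_Q:T^*Q\to Q$ be the cotangent bundle with its canonical symplectic form $\omega_Q=dq^i\wedge dp_i$; for $F\in C^\infty(T^*Q)$ let $X_F$ be the Hamiltonian vector field, $i_{X_F}\omega_Q=dF$, and let $\{F,G\}_{can}=\omega_Q(X_F,X_G)$. Let $D^\circ\subseteq T^*Q$ be the annihilator of $D$, let $M=\flat_g(D)\subseteq T^*Q$ be the constraint submanifold, where $\flat_g(v)=g(v,\cdot)$, with inclusion $i_M:M\to T^*Q$, and let $\gamma:T^*Q\to M$ be the projection given by the orthogonal decomposition $T^*Q=M\oplus D^\circ$. Put $T^DM=\{Z\in TM : T\pi_Q(Z)\in D\}$, and let $(T^DM)^{\perp_{\omega_Q}}$ be its symplectic orthogonal complement in $T_M(T^*Q)$, the restriction of $T(T^*Q)$ to $M$. Then $T_M(T^*Q)=T^DM\oplus (T^DM)^{\perp_{\omega_Q}}$; let $\mathcal P:T_M(T^*Q)\to T^DM$ be the associated projection. Moreover $f\circ\gamma\in C^\infty(T^*Q)$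 for every $f\in C^\infty(M)$, and for all $f_1,f_2\in C^\infty(M)$ and all extensions $\tilde f_1,\tilde f_2\in C^\infty(T^*Q)$ of $f_1,f_2$ the nonholonomic bracket equals the Eden bracket: $$\{f_1,f_2\}_{nh}:=\omega_Q(\mathcal P X_{\tilde f_1},\mathcal P X_{\tilde f_2})\circ i_M=\{f_1\circ\gamma,f_2\circ\gamma\}_{can}\circ i_M=:\{f_1,f_2\}_E .$$ -/

import Mathlib

open Bundle Set Filter Topology
open scoped Manifold ContDiff

noncomputable section

namespace Nonholonomic

/-! ### The cotangent bundle of a manifold and its canonical symplectic form -/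

/-- The cotangent bundle `T*Q`; an element is a pair `β = ⟨q, β_q⟩` with `β_q ∈ T*_q Q`. It carries
Mathlib's smooth manifold structure of the (total space of the) bundle of linear maps
from the tangent bundle to the trivial line bundle. -/
abbrev CotangentBundle (E : Type*) [NormedAddCommGroup E] [NormedSpace ℝ E]
    (Q : Type*) [TopologicalSpace Q] [ChartedSpace E Q] : Type _ :=
  TotalSpace (E →L[ℝ] ℝ) (fun q : Q => TangentSpace 𝓘(ℝ, E) q →L[ℝ] Bundle.Trivial Q ℝ q)

/-- The model with corners of the manifold `T*Q`: the model space is `E × E*`. -/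
abbrev cotangentModel (E : Type*) [NormedAddCommGroup E] [NormedSpace ℝ E] :
    ModelWithCorners ℝ (E × (E →L[ℝ] ℝ)) (ModelProd E (E →L[ℝ] ℝ)) :=
  𝓘(ℝ, E).prod 𝓘(ℝ, E →L[ℝ] ℝ)

/-- The 2-form `a^i ∧ b_i`, that is `(Z, W) ↦ a^i(Z) b_i(W) - a^i(W) b_i(Z)`, for linear maps `a` and
`b` with values in `E` and in `E*`. -/
def wedgePairing {V E : Type*} [AddCommGroup V] [Module ℝ V] [NormedAddCommGroup E]
    [NormedSpace ℝ E] (a : V →ₗ[ℝ] E) (b : V →ₗ[ℝ] (E →L[ℝ] ℝ)) : LinearMap.BilinForm ℝ V :=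
  LinearMap.mk₂ ℝ (fun Z W => b W (a Z) - b Z (a W))
    (fun Z Z' W => by simp only [map_add, add_apply]; ring)
    (fun c Z W => by simp only [map_smul, smul_apply, smul_eq_mul]; ring)
    (fun Z W W' => by simp only [map_add, add_apply]; ring)
    (fun c Z W => by simp only [map_smul, smul_apply, smul_eq_mul]; ring)

theorem wedgePairing_nondegenerate {V E : Type*} [AddCommGroup V] [Module ℝ V]
    [NormedAddCommGroup E] [NormedSpace ℝ E] (a : V →ₗ[ℝ] E) (b : V →ₗ[ℝ] (E →L[ℝ] ℝ))
    (hab : Function.Bijective fun Z => (a Z, b Z)) : (wedgePairing a b).Nondegenerate := by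
  have key : ∀ Z, (∀ W, b W (a Z) - b Z (a W) = 0) → Z = 0 := by
    intro Z hZ
    have hb : b Z = 0 := by
      ext v
      obtain ⟨W, hW⟩ := hab.2 (v, 0)
      have h1 : a W = v := congrArg Prod.fst hW
      have h2 : b W = 0 := congrArg Prod.snd hW
      have := hZ W
      rw [h1, h2] at this
      simpa using this
    have ha : a Z = 0 := by
      by_contra hne
      obtain ⟨φ, hφ⟩ := SeparatingDual.exists_ne_zero (R := ℝ) hne
      obtain ⟨W, hW⟩ := hab.2 (0, φ)
      have h1 : a W = 0 := congrArg Prod.fst hW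
      have h2 : b W = φ := congrArg Prod.snd hW
      have := hZ W
      rw [h1, h2] at this
      exact hφ (by simpa using this)
    exact hab.1 (by simp [ha, hb])
  refine ⟨fun Z hZ => key Z hZ, fun Z hZ => key Z fun W => ?_⟩
  have := hZ W
  simp only [wedgePairing, LinearMap.mk₂_apply] at this
  linarith

section Definitions

variable {E : Type*} [NormedAddCommGroup E] [NormedSpace ℝ E]
  {Q : Type*} [TopologicalSpace Q] [ChartedSpace E Q]

instance [FiniteDimensional ℝ E] (q : Q) : FiniteDimensional ℝ (TangentSpace 𝓘(ℝ, E) q) :=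
  inferInstanceAs (FiniteDimensional ℝ E)

/-- The position part `β ↦ (q^i)` of the canonical coordinates on `T*Q` induced by the chart of `Q`
at `q₀`. -/
def positionCoord (q₀ : Q) (β : CotangentBundle E Q) : E :=
  extChartAt 𝓘(ℝ, E) q₀ β.proj

/-- The momentum part `β ↦ (p_i)` of the canonical coordinates on `T*Q` induced by the chart of `Q`
at `q₀`: the covector `p ∈ E*` with `β = p ∘ d(chart) = p_i dq^i`. -/
def momentumCoord (q₀ : Q) (β : CotangentBundle E Q) : E →L[ℝ] ℝ :=
  β.2 ∘L (mfderiv 𝓘(ℝ, E) 𝓘(ℝ, E) (extChartAt 𝓘(ℝ, E) q₀) β.proj).inverse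

variable [IsManifold 𝓘(ℝ, E) ∞ Q]

instance [FiniteDimensional ℝ E] (β : CotangentBundle E Q) :
    FiniteDimensional ℝ (TangentSpace (cotangentModel E) β) :=
  inferInstanceAs (FiniteDimensional ℝ (E × (E →L[ℝ] ℝ)))

/-- The differential `dq` at `β`, in the canonical coordinates around `β`. -/
def dPosition (β : CotangentBundle E Q) : TangentSpace (cotangentModel E) β →L[ℝ] E :=
  mfderiv (cotangentModel E) 𝓘(ℝ, E) (positionCoord β.proj) β

/-- The differential `dp` at `β`, in the canonical coordinates around `β`. -/
def dMomentum (β : CotangentBundle E Q) :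
    TangentSpace (cotangentModel E) β →L[ℝ] (E →L[ℝ] ℝ) :=
  mfderiv (cotangentModel E) 𝓘(ℝ, E →L[ℝ] ℝ) (momentumCoord β.proj) β

/-- The canonical symplectic form `ω_Q = dq^i ∧ dp_i` of `T*Q` at the point `β`, that is,
`ω_Q(Z, W) = dq^i(Z) dp_i(W) - dq^i(W) dp_i(Z)`. -/
def canonicalForm (β : CotangentBundle E Q) :
    LinearMap.BilinForm ℝ (TangentSpace (cotangentModel E) β) :=
  wedgePairing (dPosition β).toLinearMap (dMomentum β).toLinearMap

/-- The preferred chart of `T*Q` at `α` is given by the canonical coordinates. -/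
theorem extChartAt_cotangent_eventuallyEq (α : CotangentBundle E Q) :
    (extChartAt (cotangentModel E) α : CotangentBundle E Q → E × (E →L[ℝ] ℝ)) =ᶠ[𝓝 α]
      fun β => (positionCoord α.proj β, momentumCoord α.proj β) := by
  have hU : (trivializationAt E (TangentSpace 𝓘(ℝ, E)) α.proj).baseSet ∈ 𝓝 α.proj :=
    (Trivialization.open_baseSet _).mem_nhds (mem_baseSet_trivializationAt _ _ _)
  have hc : ContinuousAt (TotalSpace.proj : CotangentBundle E Q → Q) α :=
    (FiberBundle.continuous_proj (E →L[ℝ] ℝ)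
      (fun q : Q => TangentSpace 𝓘(ℝ, E) q →L[ℝ] Bundle.Trivial Q ℝ q)).continuousAt
  filter_upwards [hc hU] with β hβ
  have hβ' : β.proj ∈ (trivializationAt E (TangentSpace 𝓘(ℝ, E)) α.proj).baseSet := hβ
  have hinv : (mfderiv 𝓘(ℝ, E) 𝓘(ℝ, E) (extChartAt 𝓘(ℝ, E) α.proj) β.proj).inverse =
      (trivializationAt E (TangentSpace 𝓘(ℝ, E)) α.proj).symmL ℝ β.proj := by
    rw [← TangentBundle.continuousLinearMapAt_trivializationAt hβ']
    refine ContinuousLinearMap.inverse_eq ?_ ?_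
    · ext v
      exact (trivializationAt E (TangentSpace 𝓘(ℝ, E)) α.proj).continuousLinearMapAt_symmL hβ' v
    · ext v
      exact (trivializationAt E (TangentSpace 𝓘(ℝ, E)) α.proj).symmL_continuousLinearMapAt hβ' v
  rw [FiberBundle.extChartAt]
  simp only [PartialEquiv.coe_trans, Function.comp_apply, momentumCoord, hinv]
  refine Prod.ext rfl ?_
  ext v
  change (trivializationAt ℝ (Bundle.Trivial Q ℝ) α.proj).continuousLinearMapAt ℝ β.proj
    (β.2 ((trivializationAt E (TangentSpace 𝓘(ℝ, E)) α.proj).symmL ℝ β.proj v)) = _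
  exact DFunLike.congr_fun
    (Bundle.Trivial.continuousLinearMapAt_trivialization ℝ Q ℝ β.proj) _

theorem dPosition_prod_dMomentum (α : CotangentBundle E Q) :
    Function.Bijective (fun Z => (dPosition α Z, dMomentum α Z)) := by
  have h1 := mfderiv_extChartAt_self (I := cotangentModel E) (x := α)
  have hd : MDifferentiableAt (cotangentModel E) 𝓘(ℝ, E × (E →L[ℝ] ℝ))
      (fun β => (positionCoord α.proj β, momentumCoord α.proj β)) α :=
    (mdifferentiableAt_extChartAt (mem_chart_source _ α)).congr_of_eventuallyEq
      (extChartAt_cotangent_eventuallyEq α).symm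
  rw [(extChartAt_cotangent_eventuallyEq α).mfderiv_eq] at h1
  have hp : mfderiv (cotangentModel E) 𝓘(ℝ, E) (positionCoord α.proj) α =
      ContinuousLinearMap.fst ℝ E (E →L[ℝ] ℝ) ∘L
        mfderiv (cotangentModel E) 𝓘(ℝ, E × (E →L[ℝ] ℝ))
          (fun β => (positionCoord α.proj β, momentumCoord α.proj β)) α :=
    (((ContinuousLinearMap.fst ℝ E (E →L[ℝ] ℝ)).hasMFDerivAt).comp α hd.hasMFDerivAt).mfderiv
  have hm : mfderiv (cotangentModel E) 𝓘(ℝ, E →L[ℝ] ℝ) (momentumCoord α.proj) α =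
      ContinuousLinearMap.snd ℝ E (E →L[ℝ] ℝ) ∘L
        mfderiv (cotangentModel E) 𝓘(ℝ, E × (E →L[ℝ] ℝ))
          (fun β => (positionCoord α.proj β, momentumCoord α.proj β)) α :=
    (((ContinuousLinearMap.snd ℝ E (E →L[ℝ] ℝ)).hasMFDerivAt).comp α hd.hasMFDerivAt).mfderiv
  have hid : (fun Z => (dPosition α Z, dMomentum α Z)) =
      (fun Z : TangentSpace (cotangentModel E) α => (Z : E × (E →L[ℝ] ℝ))) := by
    funext Z
    rw [dPosition, dMomentum, hp, hm, h1]
    rfl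
  rw [hid]
  exact Function.bijective_id

theorem canonicalForm_nondegenerate (β : CotangentBundle E Q) :
    (canonicalForm β).Nondegenerate :=
  wedgePairing_nondegenerate _ _ (dPosition_prod_dMomentum β)

/-- The Hamiltonian vector field `X_F` of a function `F` on `T*Q`, at the point `β`: the unique
tangent vector with `i_{X_F} ω_Q = dF`. -/
def hamiltonianVectorField [FiniteDimensional ℝ E] (F : CotangentBundle E Q → ℝ)
    (β : CotangentBundle E Q) : TangentSpace (cotangentModel E) β :=
  ((canonicalForm β).toDual (canonicalForm_nondegenerate β)).symm
    (mfderiv (cotangentModel E) 𝓘(ℝ, ℝ) F β :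
      TangentSpace (cotangentModel E) β →L[ℝ] ℝ).toLinearMap

/-- The canonical Poisson bracket `{F, G}_can = ω_Q(X_F, X_G)` on `T*Q`. -/
def canonicalBracket [FiniteDimensional ℝ E] (F G : CotangentBundle E Q → ℝ)
    (β : CotangentBundle E Q) : ℝ :=
  canonicalForm β (hamiltonianVectorField F β) (hamiltonianVectorField G β)

/-! ### Distributions, the constraint submanifold and the projector -/

/-- `D` is a smooth distribution of rank `k` on `Q` (a smooth rank `k` subbundle of `TQ`): near every
point it has a smooth local frame consisting of `k` vector fields. -/
def IsSmoothDistribution (k : ℕ) (D : ∀ q : Q, Submodule ℝ (TangentSpace 𝓘(ℝ, E) q)) : Prop :=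
  ∀ q₀ : Q, ∃ U : Set Q, IsOpen U ∧ q₀ ∈ U ∧
    ∃ X : Fin k → ∀ q : Q, TangentSpace 𝓘(ℝ, E) q,
      (∀ i, ContMDiffOn 𝓘(ℝ, E) 𝓘(ℝ, E).tangent ∞
        (fun q => (⟨q, X i q⟩ : TangentBundle 𝓘(ℝ, E) Q)) U) ∧
      ∀ q ∈ U, LinearIndependent ℝ (fun i => X i q) ∧
        Submodule.span ℝ (range fun i => X i q) = D q

/-- A smooth Riemannian metric on `Q`. -/
abbrev Metric (E : Type*) [NormedAddCommGroup E] [NormedSpace ℝ E]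
    (Q : Type*) [TopologicalSpace Q] [ChartedSpace E Q] [IsManifold 𝓘(ℝ, E) ∞ Q] : Type _ :=
  ContMDiffRiemannianMetric 𝓘(ℝ, E) ∞ E (TangentSpace 𝓘(ℝ, E) : Q → Type _)

variable (g : Metric E Q) (D : ∀ q : Q, Submodule ℝ (TangentSpace 𝓘(ℝ, E) q))

/-- The isomorphism `♭_g(q) : T_q Q → T*_q Q`, `v ↦ g_q(v, ·)`. -/
def flat (q : Q) : TangentSpace 𝓘(ℝ, E) q →ₗ[ℝ] (TangentSpace 𝓘(ℝ, E) q →L[ℝ] ℝ) :=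
  (g.inner q).toLinearMap

/-- The fibre `M_q = ♭_g(D_q)`. -/
def constraintFiber (q : Q) : Submodule ℝ (TangentSpace 𝓘(ℝ, E) q →L[ℝ] ℝ) :=
  (D q).map (flat g q)

/-- The annihilator `D_q° ⊆ T*_q Q`. -/
def annihilator (q : Q) : Submodule ℝ (TangentSpace 𝓘(ℝ, E) q →L[ℝ] ℝ) where
  carrier := {β | ∀ v ∈ D q, β v = 0}
  zero_mem' := by intro v _; simp
  add_mem' := by intro a b ha hb v hv; simp [ha v hv, hb v hv]
  smul_mem' := by intro c a ha v hv; simp [ha v hv]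

/-- The decomposition `T*Q = M ⊕ D°`. -/
theorem isCompl_constraintFiber_annihilator [FiniteDimensional ℝ E] (q : Q) :
    IsCompl (constraintFiber g D q) (annihilator D q) := by
  have hpos : ∀ w : TangentSpace 𝓘(ℝ, E) q, g.inner q w w = 0 → w = 0 := by
    intro w hw
    by_contra hne
    exact (g.pos q w hne).ne' hw
  refine ⟨Submodule.disjoint_def.2 ?_, Submodule.codisjoint_iff_exists_add_eq.2 ?_⟩
  · rintro _ ⟨w, hw, rfl⟩ h
    rw [hpos w (h w hw), map_zero]
  · intro β
    let B : D q →ₗ[ℝ] Module.Dual ℝ (D q) :=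
      { toFun := fun w => (g.inner q w).toLinearMap ∘ₗ (D q).subtype
        map_add' := fun a b => by ext; simp
        map_smul' := fun c a => by ext; simp }
    have hB : Function.Injective B := by
      rw [injective_iff_map_eq_zero]
      intro w hw
      exact Subtype.ext (hpos w (LinearMap.congr_fun hw w))
    have hB' : Function.Surjective B :=
      (LinearMap.injective_iff_surjective_of_finrank_eq_finrank
        Subspace.dual_finrank_eq.symm).1 hB
    obtain ⟨w, hw⟩ := hB' (β.toLinearMap ∘ₗ (D q).subtype)
    refine ⟨flat g q w, β - flat g q w, ⟨w, w.2, rfl⟩, ?_, by abel⟩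
    intro v hv
    have h1 : g.inner q w v = β v := LinearMap.congr_fun hw ⟨v, hv⟩
    change β v - g.inner q w v = 0
    rw [h1, sub_self]

/-- The constraint submanifold `M = ♭_g(D) ⊆ T*Q`. Its inclusion `i_M` is the coercion. -/
def constraintManifold : Set (CotangentBundle E Q) :=
  {β | β.2 ∈ constraintFiber g D β.proj}

/-- The projector `γ : T*Q → M` of the decomposition `T*Q = M ⊕ D°`
(which is orthogonal for the metric induced by `g` on covectors). -/
def edenProjector [FiniteDimensional ℝ E] (β : CotangentBundle E Q) : constraintManifold g D :=
  ⟨⟨β.proj, (constraintFiber g D β.proj).projection (annihilator D β.proj)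
      (isCompl_constraintFiber_annihilator g D β.proj) β.2⟩,
    Submodule.projection_apply_mem
      (isCompl_constraintFiber_annihilator g D β.proj) β.2⟩

/-- `f ∈ C^∞(M)`: locally, `f` is the restriction of a smooth function on an open subset of `T*Q`.
(For an embedded submanifold, these are the smooth functions.) -/
def IsSmoothOnConstraint (f : constraintManifold g D → ℝ) : Prop :=
  ∀ x : constraintManifold g D, ∃ U : Set (CotangentBundle E Q), IsOpen U ∧
    (x : CotangentBundle E Q) ∈ U ∧ ∃ F : CotangentBundle E Q → ℝ, ContMDiffOn (cotangentModel E) 𝓘(ℝ, ℝ) ∞ F U ∧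
      ∀ y : constraintManifold g D, (y : CotangentBundle E Q) ∈ U → F y = f y

/-- The tangent space `T_x M ⊆ T_x(T*Q)` of the embedded submanifold `M ⊆ T*Q`: the vectors that
annihilate every smooth function, defined on a neighbourhood of `x` in `T*Q`, that vanishes
on `M`. -/
def constraintTangent (x : constraintManifold g D) :
    Submodule ℝ (TangentSpace (cotangentModel E) (x : CotangentBundle E Q)) where
  carrier := {Z | ∀ (U : Set (CotangentBundle E Q)) (F : CotangentBundle E Q → ℝ),
    IsOpen U → (x : CotangentBundle E Q) ∈ U →
    ContMDiffOn (cotangentModel E) 𝓘(ℝ, ℝ) ∞ F U →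
    (∀ y ∈ U ∩ constraintManifold g D, F y = 0) →
    mfderiv (cotangentModel E) 𝓘(ℝ, ℝ) F (x : CotangentBundle E Q) Z = 0}
  zero_mem' := by intro U F _ _ _ _; exact ContinuousLinearMap.map_zero _
  add_mem' := by
    intro a b ha hb U F h1 h2 h3 h4
    rw [ContinuousLinearMap.map_add, ha U F h1 h2 h3 h4, hb U F h1 h2 h3 h4, add_zero]
  smul_mem' := by
    intro c a ha U F h1 h2 h3 h4
    rw [ContinuousLinearMap.map_smul, ha U F h1 h2 h3 h4, smul_zero]

/-- The fibre at `x` of the vector bundle `T^D M = {Z ∈ TM | Tπ_Q(Z) ∈ D}` over `M`. -/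
def constraintTangentD (x : constraintManifold g D) :
    Submodule ℝ (TangentSpace (cotangentModel E) (x : CotangentBundle E Q)) :=
  constraintTangent g D x ⊓
    (D (x : CotangentBundle E Q).proj).comap
      (mfderiv (cotangentModel E) 𝓘(ℝ, E) (TotalSpace.proj : CotangentBundle E Q → Q)
        (x : CotangentBundle E Q)).toLinearMap

/-- The symplectic orthogonal complement `(T^D M)^{⊥ω}` at `x`, in `T_x(T*Q)`. -/
def constraintTangentDOrth (x : constraintManifold g D) :
    Submodule ℝ (TangentSpace (cotangentModel E) (x : CotangentBundle E Q)) :=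
  (canonicalForm (x : CotangentBundle E Q)).orthogonal (constraintTangentD g D x)

/-! ### The two brackets -/

variable {g D} in
/-- For functions `F, G` on `T*Q`, the function `ω_Q(𝒫 X_F, 𝒫 X_G) ∘ i_M` on `M`, where `𝒫` is the
projection onto `T^D M` along `(T^D M)^{⊥ω}` in the decomposition `h` of `T_M(T*Q)`. When `F` and
`G` extend `f, g ∈ C^∞(M)`, this is the nonholonomic bracket of `f` and `g`. -/
def nonholonomicBracket [FiniteDimensional ℝ E]
    (h : ∀ x, IsCompl (constraintTangentD g D x) (constraintTangentDOrth g D x))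
    (F G : CotangentBundle E Q → ℝ) (x : constraintManifold g D) : ℝ :=
  canonicalForm (x : CotangentBundle E Q)
    ((constraintTangentD g D x).projection (constraintTangentDOrth g D x) (h x)
      (hamiltonianVectorField F x))
    ((constraintTangentD g D x).projection (constraintTangentDOrth g D x) (h x)
      (hamiltonianVectorField G x))

/-- The Eden bracket `{f₁, f₂}_E = {f₁ ∘ γ, f₂ ∘ γ}_can ∘ i_M` on `M`. -/
def edenBracket [FiniteDimensional ℝ E] (f₁ f₂ : constraintManifold g D → ℝ)
    (x : constraintManifold g D) : ℝ :=
  canonicalBracket (f₁ ∘ edenProjector g D) (f₂ ∘ edenProjector g D) (x : CotangentBundle E Q)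

end Definitions

end Nonholonomic

end

/-!
Let `x ∈ M` and let `P` be the derivative of `γ : T*Q → T*Q` at its fixed point `x`. Everything at
`x` is controlled by `P`. Since `γ ∘ γ = γ` and `M` is the fixed point set of `γ`, the map `P` is
idempotent and `T_x M` is its space of fixed vectors (`mem_constraintTangent_iff`). Since `γ`
preserves the fibres of `T*Q → Q`, `P` preserves the position part of a tangent vector; and since
`γ` is linear on fibres with kernel `D°`, `P` kills exactly those vertical vectors whose momentum
part lies in `D°` (`isTangentProjector_tangentProjector`).

The rest at `x` is linear algebra (`IsTangentProjector`). Let `P'` be the adjoint of `P` for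
`ω = ω_Q`, so `ω(P' X, W) = ω(X, P W)`. As `P` kills the vertical vectors with momentum part in
`D°`, the position part of `P' X` is annihilated by `D°`, so it lies in `D`; hence `P P' X ∈ T^D M`.
For every `U` the vector `P U - U` is vertical with momentum part in `D°`, so `ω(P U, W) = ω(U, W)`
whenever the position part of `W` lies in `D`. Thus
`ω(P P' X, W) = ω(P' X, W) = ω(X, P W) = ω(X, W)` for `W ∈ T^D M`, that is,
`X - P P' X ∈ (T^D M)^⊥`. This gives the decomposition (`isCompl_orthogonal`), with projection
`𝒫 = P P'` (`projection_eq`), and `ω(𝒫 X, 𝒫 Y) = ω(P' X, P' Y)` (`wedgePairing_projection`). The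
brackets agree because `d(F ∘ γ) = dF ∘ P` says `X_{F ∘ γ} = P' X_F`
(`canonicalForm_hamiltonianVectorField_comp`).

Smoothness of `γ` (`contMDiff_ambientProjector`) comes from its expression in a local frame of `D`
through the inverse of the Gram matrix; then `f ∘ γ` is smooth since locally `f ∘ γ = F ∘ γ` for a
smooth local extension `F` of `f`.
-/

namespace Nonholonomic

/-! ### Linear algebra of the tangent projector -/

section LinearAlgebra

variable {V E : Type*} [AddCommGroup V] [Module ℝ V] [NormedAddCommGroup E] [NormedSpace ℝ E]
  {a : V →ₗ[ℝ] E} {b : V →ₗ[ℝ] (E →L[ℝ] ℝ)}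

theorem wedgePairing_apply (Z W : V) : wedgePairing a b Z W = b W (a Z) - b Z (a W) := rfl

theorem wedgePairing_swap (Z W : V) : wedgePairing a b Z W = -wedgePairing a b W Z := by
  simp only [wedgePairing_apply]; ring

/-- Algebraic properties of the derivative `P`, at a point of the constraint submanifold, of the
projector `γ`. Here `V` is the tangent space of `T*Q`, `a` and `b` are the position and momentum
parts of a tangent vector, and `D` is the fibre of the distribution. -/
structure IsTangentProjector (a : V →ₗ[ℝ] E) (b : V →ₗ[ℝ] (E →L[ℝ] ℝ)) (D : Submodule ℝ E)
    (P : V →ₗ[ℝ] V) : Prop where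
  idem : ∀ Z, P (P Z) = P Z
  position : ∀ Z, a (P Z) = a Z
  vertical_ker : ∀ Z, a Z = 0 → (P Z = 0 ↔ ∀ v ∈ D, b Z v = 0)

namespace IsTangentProjector

variable {D : Submodule ℝ E} {P : V →ₗ[ℝ] V}

/-- The fibre of `T^D M`, expressed through `P`: the fixed vectors of `P` (its range, when `P` is
idempotent) whose position part lies in `D`. -/
def admissible (a : V →ₗ[ℝ] E) (D : Submodule ℝ E) (P : V →ₗ[ℝ] V) : Submodule ℝ V :=
  LinearMap.eqLocus P LinearMap.id ⊓ D.comap a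

theorem mem_admissible {Z : V} : Z ∈ admissible a D P ↔ P Z = Z ∧ a Z ∈ D := Iff.rfl

/-- `P U - U` is vertical and lies in the kernel of `P`, so its momentum part annihilates `D`. -/
theorem wedgePairing_apply_left (hP : IsTangentProjector a b D P) (U : V) {W : V}
    (hW : a W ∈ D) : wedgePairing a b (P U) W = wedgePairing a b U W := by
  have h0 : a (P U - U) = 0 := by rw [map_sub, hP.position, sub_self]
  have h1 := (hP.vertical_ker _ h0).1 (by rw [map_sub, hP.idem, sub_self]) _ hW
  rw [← sub_eq_zero, ← LinearMap.sub_apply, ← map_sub, wedgePairing_apply, h0, h1, map_zero,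
    sub_zero]

/-- The position part of a value of the symplectic adjoint of `P` is annihilated by `D°`, because
`P` kills the vertical vectors whose momentum part lies in `D°`. -/
theorem position_mem_of_adjoint [FiniteDimensional ℝ E]
    (hab : Function.Bijective fun Z => (a Z, b Z)) (hP : IsTangentProjector a b D P) {X U : V}
    (hU : ∀ W, wedgePairing a b U W = wedgePairing a b X (P W)) : a U ∈ D := by
  by_contra hnot
  obtain ⟨c, hc, hcD⟩ := Submodule.exists_le_ker_of_notMem hnot
  obtain ⟨Z, hZ⟩ := hab.2 (0, c.toContinuousLinearMap)
  have hZa : a Z = 0 := congrArg Prod.fst hZ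
  have hZb : b Z = c.toContinuousLinearMap := congrArg Prod.snd hZ
  have hPZ : P Z = 0 := (hP.vertical_ker Z hZa).2 fun v hv => by
    rw [hZb]; exact hcD hv
  have := hU Z
  rw [hPZ, map_zero, wedgePairing_apply, hZa, hZb, map_zero, sub_zero] at this
  exact hc this

theorem apply_mem_admissible [FiniteDimensional ℝ E]
    (hab : Function.Bijective fun Z => (a Z, b Z)) (hP : IsTangentProjector a b D P) {X U : V}
    (hU : ∀ W, wedgePairing a b U W = wedgePairing a b X (P W)) : P U ∈ admissible a D P :=
  mem_admissible.2 ⟨hP.idem U, by rw [hP.position]; exact hP.position_mem_of_adjoint hab hU⟩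

theorem wedgePairing_apply_adjoint (hP : IsTangentProjector a b D P) {X U : V}
    (hU : ∀ W, wedgePairing a b U W = wedgePairing a b X (P W)) {W : V}
    (hW : W ∈ admissible a D P) : wedgePairing a b (P U) W = wedgePairing a b X W := by
  rw [hP.wedgePairing_apply_left U hW.2, hU, (mem_admissible.1 hW).1]

theorem sub_apply_mem_orthogonal (hP : IsTangentProjector a b D P) {X U : V}
    (hU : ∀ W, wedgePairing a b U W = wedgePairing a b X (P W)) :
    X - P U ∈ (wedgePairing a b).orthogonal (admissible a D P) := by
  intro _ hW
  rw [wedgePairing_swap, map_sub, LinearMap.sub_apply,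
    hP.wedgePairing_apply_adjoint hU hW, sub_self, neg_zero]

/-- The value at `X` of the symplectic adjoint of `P` exists because the form is nondegenerate and
`V` is finite-dimensional. -/
theorem exists_adjoint [FiniteDimensional ℝ V]
    (hab : Function.Bijective fun Z => (a Z, b Z)) (X : V) :
    ∃ U, ∀ W, wedgePairing a b U W = wedgePairing a b X (P W) :=
  ⟨((wedgePairing a b).toDual (wedgePairing_nondegenerate a b hab)).symm
      (wedgePairing a b X ∘ₗ P),
    fun _ => LinearMap.BilinForm.apply_toDual_symm_apply ..⟩

/-- The admissible subspace is symplectic: if `U` is the image of `X` under the symplectic adjoint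
of `P`, then `X = P U + (X - P U)` is the decomposition of `X`. -/
theorem isCompl_orthogonal [FiniteDimensional ℝ V] [FiniteDimensional ℝ E]
    (hab : Function.Bijective fun Z => (a Z, b Z)) (hP : IsTangentProjector a b D P) :
    IsCompl (admissible a D P) ((wedgePairing a b).orthogonal (admissible a D P)) := by
  refine ⟨Submodule.disjoint_def.2 fun Z hZ hZo => ?_,
    Submodule.codisjoint_iff_exists_add_eq.2 fun X => ?_⟩
  · refine (wedgePairing_nondegenerate a b hab).2 Z fun Y => ?_
    obtain ⟨U, hU⟩ := exists_adjoint (P := P) hab Y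
    rw [← hP.wedgePairing_apply_adjoint hU hZ]
    exact hZo _ (hP.apply_mem_admissible hab hU)
  · obtain ⟨U, hU⟩ := exists_adjoint (P := P) hab X
    exact ⟨P U, X - P U, hP.apply_mem_admissible hab hU, hP.sub_apply_mem_orthogonal hU,
      add_sub_cancel _ _⟩

/-- The symplectic projector onto the admissible subspace is `P` composed with its symplectic
adjoint. -/
theorem projection_eq [FiniteDimensional ℝ E]
    (hab : Function.Bijective fun Z => (a Z, b Z)) (hP : IsTangentProjector a b D P)
    (h : IsCompl (admissible a D P) ((wedgePairing a b).orthogonal (admissible a D P))) {X U : V}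
    (hU : ∀ W, wedgePairing a b U W = wedgePairing a b X (P W)) :
    (admissible a D P).projection _ h X = P U := by
  conv_lhs => rw [← add_sub_cancel (P U) X]
  rw [map_add, Submodule.projection_apply_of_mem_left h (hP.apply_mem_admissible hab hU),
    Submodule.projection_apply_of_mem_right h (hP.sub_apply_mem_orthogonal hU), add_zero]

/-- The form on the two projections equals the form on the two values of the symplectic adjoint:
with `U₁, U₂` the latter,
`ω(P U₁, P U₂) = ω(U₁, P U₂) = ω(X₁, P P U₂) = ω(X₁, P U₂) = ω(U₁, U₂)`. -/
theorem wedgePairing_projection [FiniteDimensional ℝ E]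
    (hab : Function.Bijective fun Z => (a Z, b Z)) (hP : IsTangentProjector a b D P)
    (h : IsCompl (admissible a D P) ((wedgePairing a b).orthogonal (admissible a D P)))
    {X₁ X₂ U₁ U₂ : V}
    (hU₁ : ∀ W, wedgePairing a b U₁ W = wedgePairing a b X₁ (P W))
    (hU₂ : ∀ W, wedgePairing a b U₂ W = wedgePairing a b X₂ (P W)) :
    wedgePairing a b ((admissible a D P).projection _ h X₁)
      ((admissible a D P).projection _ h X₂) = wedgePairing a b U₁ U₂ := by
  rw [hP.projection_eq hab h hU₁, hP.projection_eq hab h hU₂,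
    hP.wedgePairing_apply_left U₁ (hP.apply_mem_admissible hab hU₂).2, hU₁, hP.idem, ← hU₁]

end IsTangentProjector

end LinearAlgebra

/-! ### Smoothness of fibrewise linear operations -/

section Smoothness

/-- Linear combinations, with smooth coefficients, of smooth maps into a vector bundle over a common
base map `b` are smooth. -/
theorem contMDiffAt_sum_smul_totalSpace {ι 𝕜 : Type*} [NontriviallyNormedField 𝕜]
    {EB : Type*} [NormedAddCommGroup EB] [NormedSpace 𝕜 EB] {HB : Type*} [TopologicalSpace HB]
    {IB : ModelWithCorners 𝕜 EB HB} {B : Type*} [TopologicalSpace B] [ChartedSpace HB B]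
    {EN : Type*} [NormedAddCommGroup EN] [NormedSpace 𝕜 EN] {HN : Type*} [TopologicalSpace HN]
    {IN : ModelWithCorners 𝕜 EN HN} {N : Type*} [TopologicalSpace N] [ChartedSpace HN N]
    {F : Type*} [NormedAddCommGroup F] [NormedSpace 𝕜 F] {V : B → Type*}
    [TopologicalSpace (TotalSpace F V)] [∀ x, TopologicalSpace (V x)]
    [∀ x, AddCommGroup (V x)] [∀ x, Module 𝕜 (V x)] [FiberBundle F V] [VectorBundle 𝕜 F V]
    {n : WithTop ℕ∞} {b : N → B} {x₀ : N} (t : Finset ι) {c : ι → N → 𝕜}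
    {s : ι → ∀ x, V (b x)} (hb : ContMDiffAt IN IB n b x₀)
    (hc : ∀ i ∈ t, ContMDiffAt IN 𝓘(𝕜, 𝕜) n (c i) x₀)
    (hs : ∀ i ∈ t, ContMDiffAt IN (IB.prod 𝓘(𝕜, F)) n
      (fun x => TotalSpace.mk' F (b x) (s i x)) x₀) :
    ContMDiffAt IN (IB.prod 𝓘(𝕜, F)) n
      (fun x => TotalSpace.mk' F (b x) (∑ i ∈ t, c i x • s i x)) x₀ := by
  rw [contMDiffAt_totalSpace]
  refine ⟨hb, ?_⟩
  have hsum : ContMDiffAt IN 𝓘(𝕜, F) n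
      (fun x => ∑ i ∈ t, c i x • (trivializationAt F V (b x₀) ⟨b x, s i x⟩).2) x₀ :=
    ContMDiffAt.sum fun i hi => (hc i hi).smul (contMDiffAt_totalSpace.1 (hs i hi)).2
  refine hsum.congr_of_eventuallyEq ?_
  filter_upwards [hb.continuousAt ((trivializationAt F V (b x₀)).open_baseSet.mem_nhds
    (mem_baseSet_trivializationAt F V (b x₀)))] with x hx
  have hlin := fun v => (trivializationAt F V (b x₀)).continuousLinearMapAt_apply_of_mem 𝕜 hx v
  simp only [TotalSpace.mk']
  rw [← hlin, map_sum]
  exact Finset.sum_congr rfl fun i _ => by rw [map_smul, hlin]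

theorem contMDiffAt_matrix_det {EN : Type*} [NormedAddCommGroup EN] [NormedSpace ℝ EN]
    {HN : Type*} [TopologicalSpace HN]
    {IN : ModelWithCorners ℝ EN HN} {N : Type*} [TopologicalSpace N] [ChartedSpace HN N]
    {ι : Type*} [Fintype ι] [DecidableEq ι] {n : WithTop ℕ∞} {G : N → Matrix ι ι ℝ} {x₀ : N}
    (hG : ∀ i j, ContMDiffAt IN 𝓘(ℝ, ℝ) n (fun x => G x i j) x₀) :
    ContMDiffAt IN 𝓘(ℝ, ℝ) n (fun x => (G x).det) x₀ := by
  simp only [Matrix.det_apply']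
  exact ContMDiffAt.sum fun σ _ =>
    contMDiffAt_const.mul (contMDiffAt_finsetProd fun i _ => hG _ _)

theorem contMDiffAt_matrix_inv {EN : Type*} [NormedAddCommGroup EN] [NormedSpace ℝ EN]
    {HN : Type*} [TopologicalSpace HN]
    {IN : ModelWithCorners ℝ EN HN} {N : Type*} [TopologicalSpace N] [ChartedSpace HN N]
    {ι : Type*} [Fintype ι] [DecidableEq ι] {n : WithTop ℕ∞} {G : N → Matrix ι ι ℝ} {x₀ : N}
    (hG : ∀ i j, ContMDiffAt IN 𝓘(ℝ, ℝ) n (fun x => G x i j) x₀) (h0 : (G x₀).det ≠ 0) (i j : ι) :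
    ContMDiffAt IN 𝓘(ℝ, ℝ) n (fun x => (G x)⁻¹ i j) x₀ := by
  simp only [Matrix.inv_def, Matrix.smul_apply, Matrix.adjugate_apply, Ring.inverse_eq_inv',
    smul_eq_mul]
  refine ((contMDiffAt_matrix_det hG).inv₀ h0).mul (contMDiffAt_matrix_det fun k l => ?_)
  by_cases hk : k = j
  · subst hk; simpa using contMDiffAt_const
  · simpa [Matrix.updateRow_ne hk] using hG k l

variable {E : Type*} [NormedAddCommGroup E] [NormedSpace ℝ E]
  {Q : Type*} [TopologicalSpace Q] [ChartedSpace E Q] [IsManifold 𝓘(ℝ, E) ∞ Q]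

/-- A vector field on `Q` defines a fibrewise linear smooth function on `T*Q`. -/
theorem contMDiffAt_cotangent_apply {X : ∀ q : Q, TangentSpace 𝓘(ℝ, E) q}
    {β₀ : CotangentBundle E Q}
    (hX : ContMDiffAt 𝓘(ℝ, E) 𝓘(ℝ, E).tangent ∞
      (fun q => (⟨q, X q⟩ : TangentBundle 𝓘(ℝ, E) Q)) β₀.proj) :
    ContMDiffAt (cotangentModel E) 𝓘(ℝ, ℝ) ∞
      (fun β : CotangentBundle E Q => β.2 (X β.proj)) β₀ := by
  have h := ContMDiffAt.clm_bundle_apply (F₁ := E) (F₂ := ℝ) (E₁ := TangentSpace 𝓘(ℝ, E))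
    (E₂ := Bundle.Trivial Q ℝ) (IB := 𝓘(ℝ, E)) (IM := cotangentModel E) (n := ∞)
    (b := fun β : CotangentBundle E Q => β.proj) (ϕ := fun β => β.2)
    (v := fun β => X β.proj) (x := β₀) contMDiffAt_id
    (hX.comp β₀ (contMDiffAt_proj _))
  exact (contMDiffAt_totalSpace.1 h).2

theorem contMDiffAt_flat (g : Metric E Q) {X : ∀ q : Q, TangentSpace 𝓘(ℝ, E) q} {q₀ : Q}
    (hX : ContMDiffAt 𝓘(ℝ, E) 𝓘(ℝ, E).tangent ∞
      (fun q => (⟨q, X q⟩ : TangentBundle 𝓘(ℝ, E) Q)) q₀) :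
    ContMDiffAt 𝓘(ℝ, E) (cotangentModel E) ∞
      (fun q => (⟨q, flat g q (X q)⟩ : CotangentBundle E Q)) q₀ :=
  ContMDiffAt.clm_bundle_apply (F₁ := E) (F₂ := E →L[ℝ] ℝ) (E₁ := TangentSpace 𝓘(ℝ, E))
    (E₂ := fun q : Q => TangentSpace 𝓘(ℝ, E) q →L[ℝ] Bundle.Trivial Q ℝ q)
    (IB := 𝓘(ℝ, E)) (IM := 𝓘(ℝ, E)) (n := ∞) (b := fun q : Q => q) (ϕ := fun q => g.inner q)
    (v := X) (x := q₀) g.contMDiff.contMDiffAt hX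

end Smoothness

/-! ### The projector in a local frame -/

section Gram

variable {E : Type*} [NormedAddCommGroup E] [NormedSpace ℝ E]
  {Q : Type*} [TopologicalSpace Q] [ChartedSpace E Q] [IsManifold 𝓘(ℝ, E) ∞ Q]
  {g : Metric E Q}

/-- The Gram matrix of a family of tangent vectors at `q`, with entry `g(X_j, X_i)` in row `i` and
column `j`. -/
noncomputable def gramMatrix {ι : Type*} (g : Metric E Q) (q : Q)
    (X : ι → TangentSpace 𝓘(ℝ, E) q) : Matrix ι ι ℝ :=
  Matrix.of fun i j => g.inner q (X j) (X i)

/-- The Gram matrix of a linearly independent family is invertible. -/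
theorem det_gram_ne_zero {ι : Type*} [Fintype ι] [DecidableEq ι] {q : Q}
    {X : ι → TangentSpace 𝓘(ℝ, E) q} (hX : LinearIndependent ℝ X) :
    (gramMatrix g q X).det ≠ 0 := by
  intro h0
  obtain ⟨c, hc, hc0⟩ := Matrix.exists_mulVec_eq_zero_iff.2 h0
  have hw : ∀ i, g.inner q (∑ j, c j • X j) (X i) = 0 := fun i => by
    have := congrFun hc0 i
    simp only [gramMatrix, Matrix.mulVec, dotProduct, Matrix.of_apply, Pi.zero_apply] at this
    rw [← this, map_sum, _root_.sum_apply]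
    exact Finset.sum_congr rfl fun j _ => by
      rw [map_smul, _root_.smul_apply, smul_eq_mul, mul_comm]
  -- The combination is orthogonal to the family, hence to itself.
  have hw0 : ∑ j, c j • X j = 0 := by
    by_contra hne
    refine (g.pos q _ hne).ne' ?_
    conv_lhs => rw [map_sum]
    exact Finset.sum_eq_zero fun i _ => by rw [map_smul, hw, smul_zero]
  exact hc (funext (Fintype.linearIndependent_iff.1 hX c hw0))

/-- The entries of the Gram matrix are the functions of `contMDiffAt_cotangent_apply` evaluated
along the smooth covector fields `♭_g X_j`. -/
theorem contMDiffAt_gramMatrix {ι : Type*} {q₀ : Q} {X : ι → ∀ q : Q, TangentSpace 𝓘(ℝ, E) q}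
    (hX : ∀ i, ContMDiffAt 𝓘(ℝ, E) 𝓘(ℝ, E).tangent ∞
      (fun q => (⟨q, X i q⟩ : TangentBundle 𝓘(ℝ, E) Q)) q₀) (i j : ι) :
    ContMDiffAt 𝓘(ℝ, E) 𝓘(ℝ, ℝ) ∞ (fun q => gramMatrix g q (fun i => X i q) i j) q₀ :=
  (contMDiffAt_cotangent_apply (β₀ := ⟨q₀, flat g _ (X j q₀)⟩) (hX i)).comp q₀
    (contMDiffAt_flat g (hX j))

end Gram

section Projector

variable {E : Type*} [NormedAddCommGroup E] [NormedSpace ℝ E] [FiniteDimensional ℝ E]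
  {Q : Type*} [TopologicalSpace Q] [ChartedSpace E Q] [IsManifold 𝓘(ℝ, E) ∞ Q]
  (g : Metric E Q) (D : ∀ q : Q, Submodule ℝ (TangentSpace 𝓘(ℝ, E) q))

/-- The projector `γ`, as a map of `T*Q` to itself. -/
noncomputable def ambientProjector (β : CotangentBundle E Q) : CotangentBundle E Q :=
  edenProjector g D β

/-- `γ β` is characterised by `γ β ∈ M` and `β - γ β ∈ D°`. -/
theorem ambientProjector_mk_eq {q : Q} {β y : TangentSpace 𝓘(ℝ, E) q →L[ℝ] ℝ}
    (hy : y ∈ constraintFiber g D q) (hβ : β - y ∈ annihilator D q) :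
    ambientProjector g D ⟨q, β⟩ = ⟨q, y⟩ := by
  have h : (constraintFiber g D q).projection (annihilator D q)
      (isCompl_constraintFiber_annihilator g D q) β = y := by
    conv_lhs => rw [← add_sub_cancel y β]
    rw [map_add, Submodule.projection_apply_of_mem_left _ hy,
      Submodule.projection_apply_of_mem_right _ hβ, add_zero]
  exact congrArg (TotalSpace.mk q) h

theorem ambientProjector_of_mem {β : CotangentBundle E Q} (hβ : β ∈ constraintManifold g D) :
    ambientProjector g D β = β :=
  ambientProjector_mk_eq g D hβ (by rw [sub_self]; exact Submodule.zero_mem _)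

theorem ambientProjector_mem (β : CotangentBundle E Q) :
    ambientProjector g D β ∈ constraintManifold g D := (edenProjector g D β).2

variable {g D}

/-- In a frame `X` of `D`, the coefficients of `γ β` in the frame `♭_g X_i` of `M` are obtained from
the numbers `β(X_j)` by the inverse of the Gram matrix. -/
theorem ambientProjector_eq_sum {ι : Type*} [Fintype ι] [DecidableEq ι] {q : Q}
    {X : ι → TangentSpace 𝓘(ℝ, E) q} (hX : LinearIndependent ℝ X)
    (hs : Submodule.span ℝ (range X) = D q) (β : TangentSpace 𝓘(ℝ, E) q →L[ℝ] ℝ) :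
    ambientProjector g D ⟨q, β⟩ = ⟨q, ∑ i, (∑ j,
      (gramMatrix g q X)⁻¹ i j * β (X j)) • flat g q (X i)⟩ := by
  set G := gramMatrix g q X
  refine ambientProjector_mk_eq g D (Submodule.sum_mem _ fun i _ => Submodule.smul_mem _ _
    ⟨X i, hs ▸ Submodule.subset_span (mem_range_self i), rfl⟩) fun v hv => ?_
  rw [← hs] at hv
  have hmul : G.mulVec (G⁻¹.mulVec fun j => β (X j)) = fun j => β (X j) := by
    rw [Matrix.mulVec_mulVec, Matrix.mul_nonsing_inv _ (det_gram_ne_zero hX).isUnit,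
      Matrix.one_mulVec]
  induction hv using Submodule.span_induction with
  | mem v hv =>
    obtain ⟨l, rfl⟩ := hv
    -- On the frame this is the equation `G (G⁻¹ b) = b` for the vector `b = (β(X_j))_j`.
    rw [_root_.sub_apply, _root_.sum_apply, sub_eq_zero]
    refine (congrFun hmul l).symm.trans (Finset.sum_congr rfl fun i _ => ?_)
    rw [_root_.smul_apply, smul_eq_mul, mul_comm]
    rfl
  | zero => exact map_zero _
  | add v w _ _ hv hw => rw [map_add, hv, hw, add_zero]
  | smul c v _ hv => rw [map_smul, hv, smul_zero]

theorem contMDiff_ambientProjector {k : ℕ} (hD : IsSmoothDistribution k D) :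
    ContMDiff (cotangentModel E) (cotangentModel E) ∞ (ambientProjector g D) := by
  intro β₀
  obtain ⟨U, hU, hq, X, hX, hXD⟩ := hD β₀.proj
  have hXs : ∀ i, ContMDiffAt 𝓘(ℝ, E) 𝓘(ℝ, E).tangent ∞
      (fun q => (⟨q, X i q⟩ : TangentBundle 𝓘(ℝ, E) Q)) β₀.proj :=
    fun i => (hX i).contMDiffAt (hU.mem_nhds hq)
  have hproj : ContMDiffAt (cotangentModel E) 𝓘(ℝ, E) ∞
      (fun β : CotangentBundle E Q => β.proj) β₀ := contMDiffAt_proj _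
  have hflat := fun i => contMDiffAt_flat g (hXs i)
  have hgram : ∀ i j, ContMDiffAt (cotangentModel E) 𝓘(ℝ, ℝ) ∞ (fun β : CotangentBundle E Q =>
      (gramMatrix g β.proj fun i => X i β.proj) i j) β₀ :=
    fun i j => (contMDiffAt_gramMatrix hXs i j).comp β₀ hproj
  have hcoef : ∀ i ∈ Finset.univ, ContMDiffAt (cotangentModel E) 𝓘(ℝ, ℝ) ∞
      (fun β : CotangentBundle E Q => ∑ j, (gramMatrix g β.proj fun i => X i β.proj)⁻¹ i j *
        β.2 (X j β.proj)) β₀ :=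
    fun i _ => ContMDiffAt.sum fun j _ => (contMDiffAt_matrix_inv hgram
      (det_gram_ne_zero (hXD _ hq).1) i j).mul (contMDiffAt_cotangent_apply (hXs j))
  have hsum := contMDiffAt_sum_smul_totalSpace (IB := 𝓘(ℝ, E)) (F := E →L[ℝ] ℝ)
    (V := fun q : Q => TangentSpace 𝓘(ℝ, E) q →L[ℝ] Bundle.Trivial Q ℝ q) Finset.univ
    (s := fun i (β : CotangentBundle E Q) => flat g β.proj (X i β.proj)) hproj hcoef
    (fun i _ => (hflat i).comp β₀ hproj)
  refine hsum.congr_of_eventuallyEq ?_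
  filter_upwards [hproj.continuousAt (hU.mem_nhds hq)] with β hβ
  exact ambientProjector_eq_sum (hXD _ hβ).1 (hXD _ hβ).2 β.2

/-- If `F` extends `f` near `γ β`, then `f ∘ γ = F ∘ γ` near `β`. -/
theorem contMDiff_comp_edenProjector {k : ℕ} (hD : IsSmoothDistribution k D)
    {f : constraintManifold g D → ℝ} (hf : IsSmoothOnConstraint g D f) :
    ContMDiff (cotangentModel E) 𝓘(ℝ, ℝ) ∞ (f ∘ edenProjector g D) := by
  intro β
  obtain ⟨U, hU, hβ, F, hF, hFf⟩ := hf (edenProjector g D β)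
  have hγ := contMDiff_ambientProjector (g := g) hD β
  have hc := (hF.contMDiffAt (hU.mem_nhds hβ)).comp β hγ
  refine hc.congr_of_eventuallyEq ?_
  filter_upwards [hγ.continuousAt (hU.mem_nhds hβ)] with α hα
  exact (hFf (edenProjector g D α) hα).symm

end Projector

/-! ### Canonical coordinates and vertical vectors -/

section Fibers

variable {E : Type*} [NormedAddCommGroup E] [NormedSpace ℝ E]
  {Q : Type*} [TopologicalSpace Q] [ChartedSpace E Q] [IsManifold 𝓘(ℝ, E) ∞ Q]

theorem mdifferentiableAt_positionCoord_momentumCoord (β : CotangentBundle E Q) :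
    MDifferentiableAt (cotangentModel E) 𝓘(ℝ, E × (E →L[ℝ] ℝ))
      (fun α => (positionCoord β.proj α, momentumCoord β.proj α)) β :=
  (mdifferentiableAt_extChartAt (mem_chart_source _ β)).congr_of_eventuallyEq
    (extChartAt_cotangent_eventuallyEq β).symm

theorem mdifferentiableAt_positionCoord (β : CotangentBundle E Q) :
    MDifferentiableAt (cotangentModel E) 𝓘(ℝ, E) (positionCoord β.proj) β :=
  (ContinuousLinearMap.fst ℝ E (E →L[ℝ] ℝ)).mdifferentiableAt.comp β
    (mdifferentiableAt_positionCoord_momentumCoord β)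

theorem mdifferentiableAt_momentumCoord (β : CotangentBundle E Q) :
    MDifferentiableAt (cotangentModel E) 𝓘(ℝ, E →L[ℝ] ℝ) (momentumCoord β.proj) β :=
  (ContinuousLinearMap.snd ℝ E (E →L[ℝ] ℝ)).mdifferentiableAt.comp β
    (mdifferentiableAt_positionCoord_momentumCoord β)

/-- At a point, `dq` is the tangent map of `T*Q → Q`: the coordinates are those of the chart of `Q`
whose derivative identifies `T_q Q` with `E`. -/
theorem dPosition_apply (β : CotangentBundle E Q) (Z : TangentSpace (cotangentModel E) β) :
    dPosition β Z = mfderiv (cotangentModel E) 𝓘(ℝ, E)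
      (TotalSpace.proj : CotangentBundle E Q → Q) β Z := by
  have hproj : MDifferentiableAt (cotangentModel E) 𝓘(ℝ, E)
      (TotalSpace.proj : CotangentBundle E Q → Q) β :=
    (contMDiffAt_proj (n := ∞) _).mdifferentiableAt (by simp)
  have h := mfderiv_comp β (mdifferentiableAt_extChartAt (mem_chart_source E β.proj)) hproj
  rw [mfderiv_extChartAt_self] at h
  exact DFunLike.congr_fun h Z

/-- The inclusion into `T*Q` of the fibre over `q`, where `T_q Q` is identified with `E` by the
derivative of the preferred chart at `q`. -/
def fiberInclusion (q : Q) (c : E →L[ℝ] ℝ) : CotangentBundle E Q := ⟨q, c⟩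

theorem contMDiff_fiberInclusion (q : Q) :
    ContMDiff 𝓘(ℝ, E →L[ℝ] ℝ) (cotangentModel E) ∞ (fiberInclusion (E := E) q) := by
  intro c
  rw [contMDiffAt_totalSpace]
  refine ⟨contMDiffAt_const, ?_⟩
  let e := trivializationAt (E →L[ℝ] ℝ)
    (fun q : Q => TangentSpace 𝓘(ℝ, E) q →L[ℝ] Bundle.Trivial Q ℝ q) q
  let L : (E →L[ℝ] ℝ) →L[ℝ] (E →L[ℝ] ℝ) := e.continuousLinearMapAt ℝ q
  have h : ContMDiffAt 𝓘(ℝ, E →L[ℝ] ℝ) 𝓘(ℝ, E →L[ℝ] ℝ) ∞ L c := L.contMDiff.contMDiffAt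
  refine h.congr_of_eventuallyEq (Filter.Eventually.of_forall fun c' => ?_)
  exact (e.continuousLinearMapAt_apply_of_mem ℝ (mem_baseSet_trivializationAt _ _ q) _).symm

theorem mdifferentiableAt_fiberInclusion (q : Q) (c : E →L[ℝ] ℝ) :
    MDifferentiableAt 𝓘(ℝ, E →L[ℝ] ℝ) (cotangentModel E) (fiberInclusion (E := E) q) c :=
  (contMDiff_fiberInclusion q c).mdifferentiableAt (by simp)

theorem momentumCoord_fiberInclusion (q : Q) (c : E →L[ℝ] ℝ) :
    momentumCoord q (fiberInclusion q c) = c := by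
  change c ∘L (mfderiv 𝓘(ℝ, E) 𝓘(ℝ, E) (extChartAt 𝓘(ℝ, E) q) q).inverse = c
  rw [mfderiv_extChartAt_self]
  exact (congrArg (c ∘L ·) ContinuousLinearMap.inverse_id).trans (ContinuousLinearMap.comp_id c)

/-- The covector `β_q` of `β = ⟨q, β_q⟩`, with the same identification of `T_q Q` with `E`. -/
def fiberCovector (β : CotangentBundle E Q) : E →L[ℝ] ℝ := β.2

/-- The vertical tangent vector at `β` with momentum part `c`. -/
noncomputable def verticalLift (β : CotangentBundle E Q) :
    (E →L[ℝ] ℝ) →L[ℝ] TangentSpace (cotangentModel E) β :=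
  mfderiv 𝓘(ℝ, E →L[ℝ] ℝ) (cotangentModel E) (fiberInclusion (E := E) β.proj) (fiberCovector β)

theorem dPosition_verticalLift (β : CotangentBundle E Q) (c : E →L[ℝ] ℝ) :
    dPosition β (verticalLift β c) = 0 := by
  have h := mfderiv_comp (I := 𝓘(ℝ, E →L[ℝ] ℝ)) (f := fiberInclusion (E := E) β.proj)
    (fiberCovector β) (mdifferentiableAt_positionCoord β) (mdifferentiableAt_fiberInclusion _ _)
  have hconst : positionCoord β.proj ∘ fiberInclusion (E := E) β.proj =
      fun _ : E →L[ℝ] ℝ => extChartAt 𝓘(ℝ, E) β.proj β.proj := rfl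
  rw [hconst, mfderiv_const] at h
  exact (DFunLike.congr_fun h c).symm

theorem dMomentum_verticalLift (β : CotangentBundle E Q) (c : E →L[ℝ] ℝ) :
    dMomentum β (verticalLift β c) = c := by
  have h := mfderiv_comp (I := 𝓘(ℝ, E →L[ℝ] ℝ)) (f := fiberInclusion (E := E) β.proj)
    (fiberCovector β) (mdifferentiableAt_momentumCoord β) (mdifferentiableAt_fiberInclusion _ _)
  have hid : momentumCoord β.proj ∘ fiberInclusion (E := E) β.proj = (id : (E →L[ℝ] ℝ) → _) :=
    funext fun c => momentumCoord_fiberInclusion _ c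
  rw [hid, mfderiv_id] at h
  exact (DFunLike.congr_fun h c).symm

theorem eq_verticalLift {β : CotangentBundle E Q} {Z : TangentSpace (cotangentModel E) β}
    (hZ : dPosition β Z = 0) : Z = verticalLift β (dMomentum β Z) :=
  (dPosition_prod_dMomentum β).1 (Prod.ext (hZ.trans (dPosition_verticalLift β _).symm)
    (dMomentum_verticalLift β _).symm)

end Fibers

/-! ### The derivative of the projector along the constraint submanifold -/

section Derivative

variable {E : Type*} [NormedAddCommGroup E] [NormedSpace ℝ E] [FiniteDimensional ℝ E]
  {Q : Type*} [TopologicalSpace Q] [ChartedSpace E Q] [IsManifold 𝓘(ℝ, E) ∞ Q]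
  {g : Metric E Q} {D : ∀ q : Q, Submodule ℝ (TangentSpace 𝓘(ℝ, E) q)}

/-- The derivative of `γ` at a point `x` of `M`, as an endomorphism of `T_x (T*Q)`. Since `γ x = x`
is not a definitional equality, this uses that all tangent spaces are copies of the model space
`E × E*`. -/
noncomputable def tangentProjector (x : constraintManifold g D) :
    TangentSpace (cotangentModel E) (x : CotangentBundle E Q) →L[ℝ]
      TangentSpace (cotangentModel E) (x : CotangentBundle E Q) :=
  mfderiv (cotangentModel E) (cotangentModel E) (ambientProjector g D) (x : CotangentBundle E Q)

/-- The chain rule for `F ∘ γ` at a point `x` of `M`, where `γ x = x`. -/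
theorem mfderiv_comp_ambientProjector {k : ℕ} (hD : IsSmoothDistribution k D)
    {E' : Type*} [NormedAddCommGroup E'] [NormedSpace ℝ E'] {H' : Type*} [TopologicalSpace H']
    {I' : ModelWithCorners ℝ E' H'} {N : Type*} [TopologicalSpace N] [ChartedSpace H' N]
    (x : constraintManifold g D) {F : CotangentBundle E Q → N}
    (hF : MDifferentiableAt (cotangentModel E) I' F (x : CotangentBundle E Q))
    (Z : TangentSpace (cotangentModel E) (x : CotangentBundle E Q)) :
    (mfderiv (cotangentModel E) I' (F ∘ ambientProjector g D) (x : CotangentBundle E Q) Z : E') =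
      mfderiv (cotangentModel E) I' F (x : CotangentBundle E Q) (tangentProjector x Z) := by
  have hx := ambientProjector_of_mem g D x.2
  have hγ : MDifferentiableAt (cotangentModel E) (cotangentModel E) (ambientProjector g D)
      (x : CotangentBundle E Q) :=
    (contMDiff_ambientProjector hD _).mdifferentiableAt (by simp)
  have h := mfderiv_comp (x : CotangentBundle E Q) (by rw [hx]; exact hF) hγ
  -- The chain rule produces the derivative of `F` at `γ x`; this lemma moves it to `x`.
  have hbase : ∀ y : CotangentBundle E Q, y = x → ∀ W : E × (E →L[ℝ] ℝ),
      (mfderiv (cotangentModel E) I' F y W : E') =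
        mfderiv (cotangentModel E) I' F (x : CotangentBundle E Q) W := by
    rintro _ rfl W; rfl
  exact (DFunLike.congr_fun h Z).trans (hbase _ hx _)

theorem tangentProjector_idem {k : ℕ} (hD : IsSmoothDistribution k D)
    (x : constraintManifold g D) (Z : TangentSpace (cotangentModel E) (x : CotangentBundle E Q)) :
    tangentProjector x (tangentProjector x Z) = tangentProjector x Z := by
  have h := mfderiv_comp_ambientProjector hD x (F := ambientProjector g D)
    ((contMDiff_ambientProjector hD _).mdifferentiableAt (by simp)) Z
  have hcomp : ambientProjector g D ∘ ambientProjector g D = ambientProjector g D :=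
    funext fun β => ambientProjector_of_mem g D (ambientProjector_mem g D β)
  -- The type of `mfderiv F x` involves `F`, so `γ ∘ γ = γ` cannot be rewritten in place.
  have hfun : ∀ F : CotangentBundle E Q → CotangentBundle E Q, F = ambientProjector g D →
      (mfderiv (cotangentModel E) (cotangentModel E) F (x : CotangentBundle E Q) Z :
        E × (E →L[ℝ] ℝ)) = tangentProjector x Z := by
    rintro _ rfl; rfl
  exact h.symm.trans (hfun _ hcomp)

theorem dPosition_tangentProjector {k : ℕ} (hD : IsSmoothDistribution k D)
    (x : constraintManifold g D) (Z : TangentSpace (cotangentModel E) (x : CotangentBundle E Q)) :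
    dPosition (x : CotangentBundle E Q) (tangentProjector x Z) =
      dPosition (x : CotangentBundle E Q) Z :=
  (mfderiv_comp_ambientProjector hD x (mdifferentiableAt_positionCoord _) Z).symm

/-- Along the fibre through `x`, the map `γ` is the linear projection onto `M_q` along `D_q°`. -/
theorem tangentProjector_verticalLift {k : ℕ} (hD : IsSmoothDistribution k D)
    (x : constraintManifold g D) (c : E →L[ℝ] ℝ) :
    tangentProjector x (verticalLift (x : CotangentBundle E Q) c) =
      verticalLift (x : CotangentBundle E Q)
        ((constraintFiber g D (x : CotangentBundle E Q).proj).projection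
          (annihilator D (x : CotangentBundle E Q).proj)
          (isCompl_constraintFiber_annihilator g D _) c) := by
  let q := (x : CotangentBundle E Q).proj
  let c₀ : E →L[ℝ] ℝ := fiberCovector (x : CotangentBundle E Q)
  let A₀ : (E →L[ℝ] ℝ) →ₗ[ℝ] (E →L[ℝ] ℝ) :=
    (constraintFiber g D q).projection (annihilator D q)
      (isCompl_constraintFiber_annihilator g D q)
  let A : (E →L[ℝ] ℝ) →L[ℝ] (E →L[ℝ] ℝ) := A₀.toContinuousLinearMap
  have hA : A c₀ = c₀ := Submodule.projection_apply_of_mem_left _ x.2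
  have hcomp : ambientProjector g D ∘ fiberInclusion (E := E) q = fiberInclusion q ∘ A := rfl
  have h₁ := mfderiv_comp (I := 𝓘(ℝ, E →L[ℝ] ℝ)) (f := fiberInclusion (E := E) q) c₀
    ((contMDiff_ambientProjector (g := g) hD _).mdifferentiableAt (by simp))
    (mdifferentiableAt_fiberInclusion q c₀)
  have h₂ := mfderiv_comp (I := 𝓘(ℝ, E →L[ℝ] ℝ)) (f := A) (g := fiberInclusion (E := E) q) c₀
    (mdifferentiableAt_fiberInclusion q _) A.mdifferentiableAt
  rw [← hcomp, h₁, A.mfderiv_eq] at h₂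
  -- `A c₀ = c₀` holds only propositionally, as `x` lies in `M`.
  have hbase : ∀ c₁ : E →L[ℝ] ℝ, c₁ = c₀ → ∀ W : E →L[ℝ] ℝ,
      (mfderiv 𝓘(ℝ, E →L[ℝ] ℝ) (cotangentModel E) (fiberInclusion (E := E) q) c₁ W :
        E × (E →L[ℝ] ℝ)) = verticalLift (x : CotangentBundle E Q) W := by
    rintro _ rfl W; rfl
  exact (DFunLike.congr_fun h₂ c).trans (hbase _ hA _)

/-- The tangent space of `M` consists of the fixed vectors of the derivative of `γ`, because `M` is
the set of fixed points of the retraction `γ`. -/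
theorem mem_constraintTangent_iff {k : ℕ} (hD : IsSmoothDistribution k D)
    (x : constraintManifold g D) {Z : TangentSpace (cotangentModel E) (x : CotangentBundle E Q)} :
    Z ∈ constraintTangent g D x ↔ tangentProjector x Z = Z := by
  have hx := ambientProjector_of_mem g D x.2
  have hγ := contMDiff_ambientProjector (g := g) hD
  constructor
  · intro hZ
    refine SeparatingDual.eq_iff_forall_dual_eq (R := ℝ) (V := E × (E →L[ℝ] ℝ)).2 fun ℓ => ?_
    -- The function `ℓ ∘ φ ∘ γ - ℓ ∘ φ`, for the chart `φ` at `x`, vanishes on `M`.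
    let ψ : CotangentBundle E Q → ℝ := fun β =>
      ℓ (extChartAt (cotangentModel E) (x : CotangentBundle E Q) β)
    have hψ : ContMDiffOn (cotangentModel E) 𝓘(ℝ, ℝ) ∞ ψ
        (chartAt _ (x : CotangentBundle E Q)).source :=
      ℓ.contMDiff.comp_contMDiffOn contMDiffOn_extChartAt
    have hψx := (hψ.contMDiffAt ((chartAt _ (x : CotangentBundle E Q)).open_source.mem_nhds
      (mem_chart_source _ _))).mdifferentiableAt (by simp)
    have hdψ : ∀ W, mfderiv (cotangentModel E) 𝓘(ℝ, ℝ) ψ (x : CotangentBundle E Q) W = ℓ W := by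
      intro W
      have hφ : MDifferentiableAt (cotangentModel E) 𝓘(ℝ, E × (E →L[ℝ] ℝ))
          (extChartAt (cotangentModel E) (x : CotangentBundle E Q)) (x : CotangentBundle E Q) :=
        mdifferentiableAt_extChartAt (mem_chart_source _ _)
      have h := mfderiv_comp (x : CotangentBundle E Q) ℓ.mdifferentiableAt hφ
      rw [mfderiv_extChartAt_self, ℓ.mfderiv_eq] at h
      exact DFunLike.congr_fun h W
    have hψγ : MDifferentiableAt (cotangentModel E) 𝓘(ℝ, ℝ) (ψ ∘ ambientProjector g D)
        (x : CotangentBundle E Q) :=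
      MDifferentiableAt.comp _ (by rw [hx]; exact hψx) ((hγ _).mdifferentiableAt (by simp))
    have hS := (chartAt (ModelProd E (E →L[ℝ] ℝ)) (x : CotangentBundle E Q)).open_source
    have h0 := hZ _ (ψ ∘ ambientProjector g D - ψ) (hS.inter (hS.preimage hγ.continuous))
      ⟨mem_chart_source (ModelProd E (E →L[ℝ] ℝ)) _,
        by rw [mem_preimage, hx]; exact mem_chart_source (ModelProd E (E →L[ℝ] ℝ)) _⟩
      ((hψ.comp hγ.contMDiffOn fun β hβ => hβ.2).sub (hψ.mono inter_subset_left))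
      (fun y hy => sub_eq_zero.2 (congrArg ψ (ambientProjector_of_mem g D hy.2)))
    rw [mfderiv_sub hψγ hψx] at h0
    have h1 := mfderiv_comp_ambientProjector hD x hψx Z
    rw [hdψ] at h1
    exact h1.symm.trans ((sub_eq_zero.1 h0).trans (hdψ Z))
  · intro hZ U F hU hxU hF hF0
    have hFx := (hF.contMDiffAt (hU.mem_nhds hxU)).mdifferentiableAt (by simp)
    have h0 : F ∘ ambientProjector g D =ᶠ[𝓝 (x : CotangentBundle E Q)] fun _ => (0 : ℝ) := by
      filter_upwards [hγ.continuous.continuousAt.preimage_mem_nhds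
        (by rw [hx]; exact hU.mem_nhds hxU)] with β hβ
      exact hF0 _ ⟨hβ, ambientProjector_mem g D β⟩
    have h := mfderiv_comp_ambientProjector hD x hFx Z
    rw [hZ, h0.mfderiv_eq, mfderiv_const] at h
    exact h.symm

end Derivative

/-! ### The two brackets -/

section Brackets

variable {E : Type*} [NormedAddCommGroup E] [NormedSpace ℝ E] [FiniteDimensional ℝ E]
  {Q : Type*} [TopologicalSpace Q] [ChartedSpace E Q] [IsManifold 𝓘(ℝ, E) ∞ Q]
  {g : Metric E Q} {D : ∀ q : Q, Submodule ℝ (TangentSpace 𝓘(ℝ, E) q)}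

theorem isTangentProjector_tangentProjector {k : ℕ} (hD : IsSmoothDistribution k D)
    (x : constraintManifold g D) :
    IsTangentProjector (dPosition (x : CotangentBundle E Q)).toLinearMap
      (dMomentum (x : CotangentBundle E Q)).toLinearMap (D (x : CotangentBundle E Q).proj)
      (tangentProjector x).toLinearMap where
  idem Z := tangentProjector_idem hD x Z
  position Z := dPosition_tangentProjector hD x Z
  vertical_ker Z hZ := by
    have h := tangentProjector_verticalLift hD x (dMomentum (x : CotangentBundle E Q) Z)
    rw [← eq_verticalLift hZ] at h
    have hinj : Function.Injective (verticalLift (x : CotangentBundle E Q)) :=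
      Function.LeftInverse.injective (dMomentum_verticalLift (x : CotangentBundle E Q))
    have hker := Submodule.projection_apply_eq_zero_iff
      (isCompl_constraintFiber_annihilator g D (x : CotangentBundle E Q).proj)
      (x := dMomentum (x : CotangentBundle E Q) Z)
    refine Iff.trans ?_ hker
    change tangentProjector x Z = 0 ↔ _
    rw [h]
    exact map_eq_zero_iff _ hinj

theorem constraintTangentD_eq {k : ℕ} (hD : IsSmoothDistribution k D)
    (x : constraintManifold g D) :
    constraintTangentD g D x =
      IsTangentProjector.admissible (dPosition (x : CotangentBundle E Q)).toLinearMap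
        (D (x : CotangentBundle E Q).proj) (tangentProjector x).toLinearMap := by
  ext Z
  refine and_congr (mem_constraintTangent_iff hD x) ?_
  change _ ∈ D _ ↔ dPosition (x : CotangentBundle E Q) Z ∈ D (x : CotangentBundle E Q).proj
  rw [dPosition_apply]
  rfl

theorem isCompl_constraintTangentD {k : ℕ} (hD : IsSmoothDistribution k D)
    (x : constraintManifold g D) :
    IsCompl (constraintTangentD g D x) (constraintTangentDOrth g D x) := by
  rw [constraintTangentDOrth, constraintTangentD_eq hD]
  exact (isTangentProjector_tangentProjector hD x).isCompl_orthogonal (dPosition_prod_dMomentum _)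

/-- The defining property `i_{X_F} ω_Q = dF`. -/
theorem canonicalForm_hamiltonianVectorField (F : CotangentBundle E Q → ℝ)
    (β : CotangentBundle E Q) (Z : TangentSpace (cotangentModel E) β) :
    canonicalForm β (hamiltonianVectorField F β) Z =
      mfderiv (cotangentModel E) 𝓘(ℝ, ℝ) F β Z :=
  LinearMap.BilinForm.apply_toDual_symm_apply ..

/-- On `M`, the Hamiltonian vector field of `F ∘ γ` is the image of that of `F` under the symplectic
adjoint of the derivative of `γ`. -/
theorem canonicalForm_hamiltonianVectorField_comp {k : ℕ} (hD : IsSmoothDistribution k D)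
    (x : constraintManifold g D) {F : CotangentBundle E Q → ℝ}
    (hF : ContMDiff (cotangentModel E) 𝓘(ℝ, ℝ) ∞ F)
    (Z : TangentSpace (cotangentModel E) (x : CotangentBundle E Q)) :
    canonicalForm (x : CotangentBundle E Q)
        (hamiltonianVectorField (F ∘ ambientProjector g D) (x : CotangentBundle E Q)) Z =
      canonicalForm (x : CotangentBundle E Q)
        (hamiltonianVectorField F (x : CotangentBundle E Q)) (tangentProjector x Z) := by
  rw [canonicalForm_hamiltonianVectorField, canonicalForm_hamiltonianVectorField]
  exact mfderiv_comp_ambientProjector hD x ((hF _).mdifferentiableAt (by simp)) Z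

/-- The nonholonomic bracket depends on `F` and `G` only through `F ∘ γ` and `G ∘ γ`, that is, only
through their restrictions to `M`. -/
theorem nonholonomicBracket_eq_canonicalBracket {k : ℕ} (hD : IsSmoothDistribution k D)
    (h : ∀ x, IsCompl (constraintTangentD g D x) (constraintTangentDOrth g D x))
    {F G : CotangentBundle E Q → ℝ} (hF : ContMDiff (cotangentModel E) 𝓘(ℝ, ℝ) ∞ F)
    (hG : ContMDiff (cotangentModel E) 𝓘(ℝ, ℝ) ∞ G) (x : constraintManifold g D) :
    nonholonomicBracket h F G x =
      canonicalBracket (F ∘ ambientProjector g D) (G ∘ ambientProjector g D)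
        (x : CotangentBundle E Q) := by
  -- Stated for a variable subspace `T`, so that `T^D M` can be replaced by its description through
  -- the derivative of `γ` inside the dependent projection.
  have key : ∀ (T : Submodule ℝ (TangentSpace (cotangentModel E) (x : CotangentBundle E Q)))
      (hT : IsCompl T ((canonicalForm (x : CotangentBundle E Q)).orthogonal T)),
      T = IsTangentProjector.admissible (dPosition (x : CotangentBundle E Q)).toLinearMap
        (D (x : CotangentBundle E Q).proj) (tangentProjector x).toLinearMap →
      canonicalForm (x : CotangentBundle E Q)
        (T.projection _ hT (hamiltonianVectorField F (x : CotangentBundle E Q)))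
        (T.projection _ hT (hamiltonianVectorField G (x : CotangentBundle E Q))) =
      canonicalBracket (F ∘ ambientProjector g D) (G ∘ ambientProjector g D)
        (x : CotangentBundle E Q) := by
    rintro _ hT rfl
    exact (isTangentProjector_tangentProjector hD x).wedgePairing_projection
      (dPosition_prod_dMomentum _) hT (canonicalForm_hamiltonianVectorField_comp hD x hF)
      (canonicalForm_hamiltonianVectorField_comp hD x hG)
  exact key _ (h x) (constraintTangentD_eq hD x)

end Brackets

end Nonholonomic

open Nonholonomic in
theorem mainTheorem2 {E : Type*} [NormedAddCommGroup E] [NormedSpace ℝ E] [FiniteDimensional ℝ E]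
    {Q : Type*} [TopologicalSpace Q] [ChartedSpace E Q] [IsManifold 𝓘(ℝ, E) ∞ Q]
    (g : Nonholonomic.Metric E Q) (k : ℕ)
    (D : ∀ q : Q, Submodule ℝ (TangentSpace 𝓘(ℝ, E) q)) (hD : IsSmoothDistribution k D) :
    ∃ h : ∀ x, IsCompl (constraintTangentD g D x) (constraintTangentDOrth g D x),
      (∀ f : constraintManifold g D → ℝ, IsSmoothOnConstraint g D f →
        ContMDiff (cotangentModel E) 𝓘(ℝ, ℝ) ∞ (f ∘ edenProjector g D)) ∧
      ∀ f₁ f₂ : constraintManifold g D → ℝ,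
        IsSmoothOnConstraint g D f₁ → IsSmoothOnConstraint g D f₂ →
        ∀ F₁ F₂ : CotangentBundle E Q → ℝ,
          ContMDiff (cotangentModel E) 𝓘(ℝ, ℝ) ∞ F₁ →
          ContMDiff (cotangentModel E) 𝓘(ℝ, ℝ) ∞ F₂ →
          (∀ x : constraintManifold g D, F₁ x = f₁ x) →
          (∀ x : constraintManifold g D, F₂ x = f₂ x) →
          nonholonomicBracket h F₁ F₂ = edenBracket g D f₁ f₂ := by
  refine ⟨isCompl_constraintTangentD hD, fun f hf => contMDiff_comp_edenProjector hD hf,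
    fun f₁ f₂ _ _ F₁ F₂ hF₁ hF₂ h₁ h₂ => funext fun x => ?_⟩
  have e₁ : f₁ ∘ edenProjector g D = F₁ ∘ ambientProjector g D := funext fun β => (h₁ _).symm
  have e₂ : f₂ ∘ edenProjector g D = F₂ ∘ ambientProjector g D := funext fun β => (h₂ _).symm
  rw [edenBracket, e₁, e₂]
  exact nonholonomicBracket_eq_canonicalBracket hD _ hF₁ hF₂ x
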